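/- Let $k\ge 4$. For every integer $n>k$ let $\xi(k;n)\in(0,1)$ be an arbitrary solution of $$\Bigl(1+\tfrac{x^{n-1}}2\Bigr)^{k+1}-\Bigl(1-\tfrac{x^{n-1}}2\Bigr)^{k+1}=(k+1)\,x^{\,n-k},$$ and put $$C_n(k)=\frac{\xi(k;n)^{3n-k-2}}{\frac1{k+2}\Bigl[\bigl(1+\frac{\xi(k;n)^{n-1}}2\bigr)^{k+2}-\bigl(1-\frac{\xi(k;n)^{n-1}}2\bigr)^{k+2}\Bigr]-\xi(k;n)^{n-k}} .$$ Let $(n_p)_p$ be a strictly increasing sequence of integers $>k$ with $\lim_{p\to\infty}\xi(k;n_p)^{n_p-1}=\limsup_{n\to\infty}\xi(k;n)^{n-1}$. Put $\gamma_p(k)=C_{n_p}(k)$ and $\mathbb N_0(k)=\{p:|\gamma_p(k)|<4\}$, and for $p\in\mathbb N_0(k)$ let $$K_p(t,u;k)=1+\gamma_p(k)\bigl(t-\tfrac12\bigr)\bigl(u-\tfrac12\bigr),\qquad t,u\in[0,1].$$ Let $\Gamma^k=(V,L)$ be the Cayley tree of order $k$, i.e. the tree in which every vertex has exactly $k+1$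 neighbours, let $\beta>0$, and consider on $[0,1]^V$ the Hamiltonian $$H(\sigma)=-\frac1\beta\sum_{\langle x,y\rangle\in L}\ln K_p(\sigma(x),\sigma(y);k),$$ with Lebesgue measure on $[0,1]$ as a priori measure. A Gibbs measure for this model is a probability measure $\mu$ on $[0,1]^V$ (with the product $\sigma$-algebra) that satisfies the DLR equations: for every finite $\Lambda\subset V$, $\mu=\int\mu(d\omega)\,\gamma_\Lambda(\cdot\mid\omega)$, where under $\gamma_\Lambda(\cdot\mid\omega)$ the configuration equals $\omega$ outside $\Lambda$ and its restriction to $\Lambda$ has, with respect to $|\Lambda|$-dimensional Lebesgue measure on $[0,1]^\Lambda$, density proportional to $\exp(-\beta H_\Lambda)$, with $H_\Lambda$ the part of the sum $H$ over the edges having at least one endpoint in $\Lambda$. Then for every $p\in\mathbb N_0(k)$ this model has at least two distinct translation-invariant Gibbs measures; translation invariance is meant in the strong sense of invariance under all automorphisms of the tree (in particular under all its translations). -/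

import Mathlib

open MeasureTheory Filter Topology
open scoped ENNReal

noncomputable section

namespace CayleyGibbs

/-! ### Nearest-neighbour models with spin space `[0,1]` on a locally finite graph -/

section Model

variable {V : Type*} [DecidableEq V] (G : SimpleGraph V) [G.LocallyFinite]

/-- The a priori measure on configurations in the finite volume `Λ`: the `|Λ|`-fold product of
Lebesgue measure on `[0,1]`. -/
def apriori (Λ : Finset V) : Measure (Λ → unitInterval) :=
  Measure.pi fun _ => (volume : Measure unitInterval)

/-- The configuration on all of `V` that equals `s` on `Λ` and `ω` outside `Λ`. -/
def glue (Λ : Finset V) (s : Λ → unitInterval) (ω : V → unitInterval) : V → unitInterval :=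
  fun x => if h : x ∈ Λ then s ⟨x, h⟩ else ω x

/-- The edges having at least one endpoint in `Λ`. -/
def edgesMeeting (Λ : Finset V) : Finset (Sym2 V) :=
  Λ.biUnion fun x => G.incidenceFinset x

/-- The energy in `Λ` of a configuration `σ`, for the formal Hamiltonian
`H(σ) = ∑_{⟨x,y⟩} Φ(σ(x), σ(y))` (a sum over unordered edges, with `Φ` a symmetric function):
the sum over the edges inside `Λ` and the edges that join `Λ` to its complement. -/
def energy (Φ : Sym2 unitInterval → ℝ) (Λ : Finset V) (σ : V → unitInterval) : ℝ :=
  ∑ e ∈ edgesMeeting G Λ, Φ (e.map σ)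

/-- The Boltzmann weight `exp(-β H(s ‖ ω))` of `s` in `Λ` with boundary condition `ω`. -/
def weight (β : ℝ) (Φ : Sym2 unitInterval → ℝ) (Λ : Finset V) (ω : V → unitInterval)
    (s : Λ → unitInterval) : ℝ≥0∞ :=
  ENNReal.ofReal (Real.exp (-β * energy G Φ Λ (glue Λ s ω)))

/-- The partition function in `Λ` with boundary condition `ω`. -/
def partitionFunction (β : ℝ) (Φ : Sym2 unitInterval → ℝ) (Λ : Finset V)
    (ω : V → unitInterval) : ℝ≥0∞ :=
  ∫⁻ s, weight G β Φ Λ ω s ∂(apriori Λ)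

/-- The conditional Gibbs distribution in `Λ` given `ω` outside `Λ`, as a measure on all
configurations: inside `Λ` it has density `Z⁻¹ exp(-β H(s ‖ ω))` with respect to the a priori
measure, and outside `Λ` the configuration is frozen to `ω`. -/
def gibbsDist (β : ℝ) (Φ : Sym2 unitInterval → ℝ) (Λ : Finset V) (ω : V → unitInterval) :
    Measure (V → unitInterval) :=
  ((apriori Λ).withDensity fun s => (partitionFunction G β Φ Λ ω)⁻¹ * weight G β Φ Λ ω s).map
    fun s => glue Λ s ω

/-- `μ` is a Gibbs measure at inverse temperature `β` for the Hamiltonian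
`H(σ) = ∑_{⟨x,y⟩} Φ(σ(x), σ(y))`: a probability measure on `[0,1]^V` satisfying the DLR equation
`μ(A) = ∫ μ(dω) γ_Λ(A | ω)` in every finite volume `Λ`. -/
structure IsGibbsMeasure (β : ℝ) (Φ : Sym2 unitInterval → ℝ) (μ : Measure (V → unitInterval)) :
    Prop where
  isProbabilityMeasure : IsProbabilityMeasure μ
  dlr : ∀ (Λ : Finset V) (A : Set (V → unitInterval)), MeasurableSet A →
    μ A = ∫⁻ ω, gibbsDist G β Φ Λ ω A ∂μ

end Model

/-- Translation invariance of a measure on configurations on a regular tree, in the strongest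
sense: invariance under the shift `σ ↦ σ ∘ g` by every graph automorphism `g`. This contains
invariance under the left translations for any identification of the tree with a Cayley graph,
such as that of the free product of `k + 1` cyclic groups of order two. -/
def IsTranslationInvariant {V : Type*} (G : SimpleGraph V) (μ : Measure (V → unitInterval)) :
    Prop :=
  ∀ g : G ≃g G, μ.map (fun (σ : V → unitInterval) (x : V) => σ (g x)) = μ

/-! ### The kernels -/

/-- `P_{n,k}(x) = (1 + x^{n-1}/2)^{k+1} - (1 - x^{n-1}/2)^{k+1}`, used for `n ≥ 1`. -/
def P (k n : ℕ) (x : ℝ) : ℝ :=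
  (1 + x ^ (n - 1) / 2) ^ (k + 1) - (1 - x ^ (n - 1) / 2) ^ (k + 1)

/-- `Q_{n,k}(x) = (k+1) x^{n-k}`, used for `n > k`. -/
def Q (k n : ℕ) (x : ℝ) : ℝ :=
  ((k : ℝ) + 1) * x ^ (n - k)

/-- The number `C_n(k)` computed from the value `x = ξ(k;n)`, used for `n > k ≥ 2`, where the
truncated differences in the exponents are true differences. -/
def C (k n : ℕ) (x : ℝ) : ℝ :=
  x ^ (3 * n - k - 2) /
    (1 / (2 + (k : ℝ)) * ((1 + x ^ (n - 1) / 2) ^ (k + 2) - (1 - x ^ (n - 1) / 2) ^ (k + 2))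
      - x ^ (n - k))

/-- `ξ` chooses, for every `n > k`, some solution `ξ n ∈ (0,1)` of `P_{n,k}(x) = Q_{n,k}(x)`. -/
def IsRootSequence (k : ℕ) (ξ : ℕ → ℝ) : Prop :=
  ∀ n, k < n → ξ n ∈ Set.Ioo (0 : ℝ) 1 ∧ P k n (ξ n) = Q k n (ξ n)

/-- `n` enumerates indices `k < n 0 < n 1 < …` along which `ξ(k;n)^{n-1}` converges to its
upper limit. -/
structure IsLimsupSubsequence (k : ℕ) (ξ : ℕ → ℝ) (n : ℕ → ℕ) : Prop where
  strictMono : StrictMono n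
  gt : ∀ p, k < n p
  tendsto : Tendsto (fun p => ξ (n p) ^ (n p - 1)) atTop
    (𝓝 (limsup (fun m => ξ m ^ (m - 1)) atTop))

/-- `γ_p(k) = C_{n_p}(k)`. -/
def gam (k : ℕ) (ξ : ℕ → ℝ) (n : ℕ → ℕ) (p : ℕ) : ℝ :=
  C k (n p) (ξ (n p))

/-- The set `ℕ₀(k)` of all `p` with `|γ_p(k)| < 4`. -/
def N0 (k : ℕ) (ξ : ℕ → ℝ) (n : ℕ → ℕ) : Set ℕ :=
  {p | |gam k ξ n p| < 4}

/-- `K(t,u) = 1 + γ (t - 1/2) (u - 1/2)`. -/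
def kernel (γ t u : ℝ) : ℝ :=
  1 + γ * (t - 1 / 2) * (u - 1 / 2)

/-- The pair interaction `Φ(t,u) = -(1/β) ln K(t,u)` with `K(t,u) = 1 + γ (t - 1/2) (u - 1/2)`,
as a function of the unordered pair of spins. -/
def interaction (β γ : ℝ) : Sym2 unitInterval → ℝ :=
  Sym2.lift ⟨fun t u => -(1 / β) * Real.log (kernel γ t u), fun t u => by
    simp only [kernel, mul_right_comm]⟩

end CayleyGibbs

end

namespace CayleyGibbs

/-! ### Product measures: resampling, relabelling, product densities -/

section Resampling

variable {V : Type*} [DecidableEq V]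

/-! Invariant Gibbs measures come from positive solutions `f` of the boundary law equation `∫ K(t,u)
f(u)^k du = λ f(t)`. Let `m` have density `f^(k+1)/Z`, and give each edge the weight `Ψ(t,u) = Z
K(t,u) / (λ f(t) f(u))`. The equation says exactly that `∫ Ψ(t,u) m(du) = 1`. On a tree a connected
set grows by leaves, and a leaf integrates out to `1`, so the products of `Ψ` over the edges of
finite connected sets are consistent marginal densities relative to `m`-distributed independent
spins (`lintegral_treeDensity_mono`). Compactness of the space of probability measures gives a
measure with these marginals (`exists_isTreeChain`). It is automorphism-invariant because the
densities are. It is Gibbs because each site of `Λ` lies on `k+1` edges: the factors `1/f` cancel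
the density of `m` there, leaving the Boltzmann weight up to a factor depending only on the outside
(`exists_gibbsMeasure_of_boundaryLaw`).

For the kernel at hand, `f(t) = 1 + c(t - 1/2)` is a solution as soon as `γ B = c A`, where `A = ∫
f^k` and `B = ∫ (t - 1/2) f^k`. The value `c = 0` always works. With `c = ξ^(n-1)`, the equation for
`ξ` reads `c A = ξ^(n-k)`, and the denominator of `C_n(k)` is `c² B`; hence `C_n(k) = c A / B` and
this `c` works too (`C_mul_integral_eq`). The two measures differ because the mean of a spin minus
`1/2` is zero for `c = 0` and positive for `c > 0`. -/

theorem measurable_glue_prod (Λ : Finset V) :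
    Measurable fun p : (Λ → unitInterval) × (V → unitInterval) => glue Λ p.1 p.2 := by
  refine measurable_pi_lambda _ fun x => ?_
  by_cases h : x ∈ Λ
  · simp only [glue, h, dif_pos]
    fun_prop
  · simp only [glue, h, dif_neg, not_false_eq_true]
    fun_prop

theorem measurable_glue_left (Λ : Finset V) (ω : V → unitInterval) :
    Measurable fun s : Λ → unitInterval => glue Λ s ω :=
  (measurable_glue_prod Λ).comp measurable_prodMk_right

theorem glue_glue (Λ : Finset V) (s s' : Λ → unitInterval) (ω : V → unitInterval) :
    glue Λ s (glue Λ s' ω) = glue Λ s ω := by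
  funext x
  by_cases h : x ∈ Λ <;> simp [glue, h]

theorem glue_of_mem {Λ : Finset V} {x : V} (h : x ∈ Λ) (s : Λ → unitInterval)
    (ω : V → unitInterval) : glue Λ s ω x = s ⟨x, h⟩ := by
  simp [glue, h]

theorem glue_of_notMem {Λ : Finset V} {x : V} (h : x ∉ Λ) (s : Λ → unitInterval)
    (ω : V → unitInterval) : glue Λ s ω x = ω x := by
  simp [glue, h]

variable (m : Measure unitInterval) [IsProbabilityMeasure m]

/-- Resampling the coordinates in `Λ` preserves an infinite product measure. -/
theorem map_glue_prod (Λ : Finset V) :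
    ((Measure.pi fun _ : Λ => m).prod (Measure.infinitePi fun _ : V => m)).map
      (fun p => glue Λ p.1 p.2) = Measure.infinitePi fun _ : V => m := by
  refine Measure.eq_infinitePi _ fun S t ht => ?_
  rw [Measure.map_apply (measurable_glue_prod Λ)
    (MeasurableSet.pi S.countable_toSet fun i _ => ht i)]
  -- The preimage of a cylinder box is a box: sites of `Λ` outside `S` are unconstrained and
  -- contribute a factor `1`.
  have : (fun p : (Λ → unitInterval) × (V → unitInterval) => glue Λ p.1 p.2) ⁻¹'
      (Set.pi (S : Set V) t) =
      (Set.univ.pi fun x : Λ => if (x : V) ∈ S then t x else Set.univ) ×ˢ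
        (Set.pi ((S \ Λ : Finset V) : Set V) t) := by
    ext ⟨s, ω⟩
    simp only [Set.mem_preimage, Set.mem_pi, Set.mem_prod, Finset.mem_coe, Finset.mem_sdiff,
      Set.mem_univ, true_imp_iff]
    constructor
    · intro h
      refine ⟨fun x => ?_, fun x hx => ?_⟩
      · split_ifs with hx
        · simpa [glue] using h x hx
        · trivial
      · simpa [glue, hx.2] using h x hx.1
    · rintro ⟨h1, h2⟩ x hx
      by_cases hxΛ : x ∈ Λ
      · simpa [glue, hxΛ, hx] using h1 ⟨x, hxΛ⟩
      · simpa [glue, hxΛ] using h2 x ⟨hx, hxΛ⟩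
  rw [this, Measure.prod_prod, Measure.pi_pi, Measure.infinitePi_pi _ fun i _ => ht i,
    Finset.univ_eq_attach, Finset.prod_attach Λ (fun x => m (if x ∈ S then t x else Set.univ)),
    ← Finset.prod_inter_mul_prod_sdiff S Λ (fun x => m (t x))]
  congr 1
  rw [Finset.inter_comm, ← Finset.filter_mem_eq_inter, Finset.prod_filter]
  refine Finset.prod_congr rfl fun x _ => ?_
  split_ifs <;> simp

theorem lintegral_infinitePi_eq_glue (Λ : Finset V) {h : (V → unitInterval) → ℝ≥0∞}
    (hh : Measurable h) :
    ∫⁻ ω, h ω ∂(Measure.infinitePi fun _ : V => m) =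
      ∫⁻ ω, ∫⁻ s, h (glue Λ s ω) ∂(Measure.pi fun _ : Λ => m)
        ∂(Measure.infinitePi fun _ : V => m) := by
  conv_lhs => rw [← map_glue_prod m Λ]
  rw [lintegral_map hh (measurable_glue_prod Λ),
    lintegral_prod_symm _ (by exact (hh.comp (measurable_glue_prod Λ)).aemeasurable)]

theorem lintegral_infinitePi_eq_update (x : V) {h : (V → unitInterval) → ℝ≥0∞}
    (hh : Measurable h) :
    ∫⁻ ω, h ω ∂(Measure.infinitePi fun _ : V => m) =
      ∫⁻ ω, ∫⁻ u, h (Function.update ω x u) ∂m ∂(Measure.infinitePi fun _ : V => m) := by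
  rw [lintegral_infinitePi_eq_glue m {x} hh]
  refine lintegral_congr fun ω => ?_
  rw [← (measurePreserving_eval (fun _ : ({x} : Finset V) => m)
    ⟨x, Finset.mem_singleton_self x⟩).lintegral_comp
    (f := fun u => h (Function.update ω x u)) (by fun_prop)]
  refine lintegral_congr fun s => ?_
  congr 1
  funext y
  by_cases hy : y = x
  · subst hy; simp [glue]
  · simp [glue, hy]

end Resampling

/-- Relabelling the coordinates preserves an infinite product of identical factors. -/
theorem map_comp_equiv_infinitePi {V : Type*} (m : Measure unitInterval)
    [IsProbabilityMeasure m] (g : V ≃ V) :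
    (Measure.infinitePi fun _ : V => m).map (fun (σ : V → unitInterval) (x : V) => σ (g x)) =
      Measure.infinitePi fun _ : V => m := by
  refine Measure.eq_infinitePi _ fun S t ht => ?_
  rw [Measure.map_apply (by fun_prop) (MeasurableSet.pi S.countable_toSet fun i _ => ht i)]
  have : (fun (σ : V → unitInterval) (x : V) => σ (g x)) ⁻¹' (Set.pi (S : Set V) t) =
      Set.pi ((S.map g.toEmbedding : Finset V) : Set V) (fun y => t (g.symm y)) := by
    ext σ
    simp only [Set.mem_preimage, Set.mem_pi, Finset.mem_coe, Finset.mem_map_equiv]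
    exact ⟨fun h i hi => by simpa using h _ hi, fun h i hi => by simpa using h (g i) (by simpa)⟩
  rw [this, Measure.infinitePi_pi _ fun i _ => ht _, Finset.prod_map]
  simp

/-- On a box, the indicator times the product density is a product of functions of independent
coordinates, so its integral factorises. -/
theorem pi_withDensity {ι : Type*} [Fintype ι] {ρ : unitInterval → ℝ≥0∞} (hρ : Measurable ρ)
    [IsProbabilityMeasure ((volume : Measure unitInterval).withDensity ρ)] :
    (Measure.pi fun _ : ι => (volume : Measure unitInterval).withDensity ρ) =
      (Measure.pi fun _ : ι => (volume : Measure unitInterval)).withDensity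
        fun s => ∏ i, ρ (s i) := by
  refine Measure.pi_eq fun t ht => ?_
  have hind : ProbabilityTheory.iIndepFun (fun i (s : ι → unitInterval) =>
      (t i).indicator ρ (s i)) (Measure.pi fun _ : ι => (volume : Measure unitInterval)) :=
    ProbabilityTheory.iIndepFun_pi fun i => (hρ.indicator (ht i)).aemeasurable
  rw [withDensity_apply _ (MeasurableSet.univ_pi ht),
    ← lintegral_indicator (MeasurableSet.univ_pi ht)]
  have heq : ∀ s : ι → unitInterval, (Set.univ.pi t).indicator (fun s => ∏ i, ρ (s i)) s =
      ∏ i, (t i).indicator ρ (s i) := by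
    intro s
    by_cases hs : s ∈ Set.univ.pi t
    · rw [Set.indicator_of_mem hs]
      exact Finset.prod_congr rfl fun i _ => (Set.indicator_of_mem (hs i trivial) _).symm
    · rw [Set.indicator_of_notMem hs]
      obtain ⟨i, hi⟩ : ∃ i, s i ∉ t i := by simpa [Set.mem_pi] using hs
      exact (Finset.prod_eq_zero (Finset.mem_univ i) (Set.indicator_of_notMem hi _)).symm
  simp_rw [heq]
  rw [ProbabilityTheory.lintegral_prod_eq_prod_lintegral_of_indepFun Finset.univ _ hind
    fun i => (hρ.indicator (ht i)).comp (measurable_pi_apply i)]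
  refine Finset.prod_congr rfl fun i _ => ?_
  rw [(measurePreserving_eval (fun _ : ι => (volume : Measure unitInterval)) i).lintegral_comp
    (hρ.indicator (ht i)), lintegral_indicator (ht i), withDensity_apply _ (ht i)]

/-! ### Consistent densities on finite subtrees -/

section TreeDensity

variable {V : Type*} {G : SimpleGraph V}

/-- A proper connected subset of a connected set can be enlarged by an adjacent vertex. -/
theorem exists_adj_of_ssubset {Δ Δ' : Finset V} (hne : Δ.Nonempty) (hss : Δ ⊂ Δ')
    (hΔ' : (G.induce (Δ' : Set V)).Preconnected) :
    ∃ x ∈ Δ', x ∉ Δ ∧ ∃ y ∈ Δ, G.Adj y x := by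
  obtain ⟨a, ha⟩ := hne
  obtain ⟨b, hb, hbΔ⟩ := Finset.exists_of_ssubset hss
  obtain ⟨w⟩ := hΔ' ⟨a, hss.1 ha⟩ ⟨b, hb⟩
  obtain ⟨d, -, h1, h2⟩ := w.exists_boundary_dart {v | (v : V) ∈ Δ} ha hbΔ
  exact ⟨d.snd, d.snd.2, h2, d.fst, h1, d.adj⟩

/-- In an acyclic graph, a vertex has at most one neighbour in a connected set avoiding it. -/
theorem eq_of_adj_of_adj (hG : G.IsAcyclic) {Δ : Set V} (hΔ : (G.induce Δ).Preconnected)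
    {x y z : V} (hx : x ∉ Δ) (hy : y ∈ Δ) (hz : z ∈ Δ) (hxy : G.Adj x y) (hxz : G.Adj x z) :
    y = z := by
  classical
  obtain ⟨p, hp⟩ := (hΔ ⟨y, hy⟩ ⟨z, hz⟩).exists_isPath
  let q : G.Walk y z := p.map (SimpleGraph.Embedding.induce Δ).toHom
  have hq : q.IsPath := hp.map Subtype.val_injective
  have hxq : x ∉ q.support := by
    intro h
    obtain ⟨v, -, hv⟩ := List.mem_map.1
      ((SimpleGraph.Walk.support_map (SimpleGraph.Embedding.induce Δ).toHom p) ▸ h)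
    exact hx (hv ▸ v.2)
  -- The path from `y` to `z` extended by `x` is still a path; `y` lies on it and is adjacent to its
  -- end, so in an acyclic graph `y` is its penultimate vertex `z`.
  have := hG.eq_penultimate_of_adj_end (hq.concat hxq hxz.symm) hxy (by simp)
  simpa using this

theorem connected_insert [DecidableEq V] {Δ : Finset V} {x y : V}
    (hΔ : (G.induce (Δ : Set V)).Connected)
    (hy : y ∈ Δ) (hyx : G.Adj y x) : (G.induce ((insert x Δ : Finset V) : Set V)).Connected := by
  have := SimpleGraph.connected_induce_union (t := {x}) hΔ.preconnected
    (SimpleGraph.Preconnected.of_subsingleton) hy rfl hyx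
  rwa [Set.union_singleton, ← Finset.coe_insert] at this

theorem connected_singleton (x : V) : (G.induce (({x} : Finset V) : Set V)).Connected := by
  rw [Finset.coe_singleton]
  exact ⟨SimpleGraph.Preconnected.of_subsingleton⟩

/-- Every finite set of vertices lies in a finite connected one. -/
theorem exists_connected_superset (hG : G.Connected) (S : Finset V) :
    ∃ T, S ⊆ T ∧ (G.induce (T : Set V)).Connected := by
  classical
  obtain ⟨o⟩ := hG.nonempty
  obtain ⟨T, hT, hc⟩ := SimpleGraph.extend_finset_to_connected hG.preconnected
    (Finset.insert_nonempty o S)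
  exact ⟨T, (Finset.subset_insert _ _).trans hT, hc⟩

/-- The vertices joined to `o` by a walk of length `n` form a finite set, and these sets exhaust
`V`. -/
theorem countable_of_connected [G.LocallyFinite] (hG : G.Connected) : Countable V := by
  classical
  obtain ⟨o⟩ := hG.nonempty
  let B : ℕ → Finset V := fun n => Nat.rec (motive := fun _ => Finset V) {o}
    (fun _ S => S.biUnion fun v => G.neighborFinset v) n
  have hB : ∀ v (w : G.Walk v o), v ∈ B w.length := by
    intro v w
    induction w with
    | nil => exact Finset.mem_singleton_self _
    | cons h p ih =>
      exact Finset.mem_biUnion.2 ⟨_, ih, (G.mem_neighborFinset _ _).2 h.symm⟩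
  have : (⋃ n, (B n : Set V)) = Set.univ := by
    refine Set.eq_univ_of_forall fun v => ?_
    obtain ⟨w⟩ := hG.preconnected v o
    exact Set.mem_iUnion.2 ⟨_, hB v w⟩
  exact Set.countable_univ_iff.1 (this ▸ Set.countable_iUnion fun n => (B n).countable_toSet)

theorem measurable_edge {Ψ : Sym2 unitInterval → ℝ≥0∞}
    (hΨ : Measurable fun p : unitInterval × unitInterval => Ψ s(p.1, p.2))
    (e : Sym2 V) : Measurable fun ω : V → unitInterval => Ψ (e.map ω) := by
  induction e with
  | _ a b =>
    exact hΨ.comp (f := fun ω : V → unitInterval => (ω a, ω b)) (by fun_prop)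

theorem map_edge_congr {e : Sym2 V} {ω ω' : V → unitInterval} (h : ∀ v ∈ e, ω v = ω' v) :
    e.map ω = e.map ω' :=
  Sym2.map_congr h

variable [DecidableEq V] (G) [G.LocallyFinite]

theorem mem_edgesMeeting {Λ : Finset V} {e : Sym2 V} :
    e ∈ edgesMeeting G Λ ↔ e ∈ G.edgeSet ∧ ∃ x ∈ Λ, x ∈ e := by
  simp only [edgesMeeting, Finset.mem_biUnion, SimpleGraph.mem_incidenceFinset,
    SimpleGraph.incidenceSet, Set.mem_sep_iff]
  tauto

/-- The edges having both endpoints in `Δ`. -/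
noncomputable def innerEdges (Δ : Finset V) : Finset (Sym2 V) :=
  haveI := Classical.decPred fun e : Sym2 V => ∀ v ∈ e, v ∈ Δ
  (edgesMeeting G Δ).filter fun e => ∀ v ∈ e, v ∈ Δ

theorem mem_innerEdges {Δ : Finset V} {e : Sym2 V} :
    e ∈ innerEdges G Δ ↔ e ∈ G.edgeSet ∧ ∀ v ∈ e, v ∈ Δ := by
  simp only [innerEdges, Finset.mem_filter, mem_edgesMeeting]
  refine ⟨fun h => ⟨h.1.1, h.2⟩, fun h => ⟨⟨h.1, ?_⟩, h.2⟩⟩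
  induction e with
  | _ a b => exact ⟨a, h.2 a (Sym2.mem_mk_left a b), Sym2.mem_mk_left a b⟩

theorem innerEdges_insert {Δ : Finset V} {x y : V} (hx : x ∉ Δ) (hy : y ∈ Δ) (hyx : G.Adj y x)
    (huniq : ∀ z ∈ Δ, G.Adj x z → z = y) :
    innerEdges G (insert x Δ) = insert s(x, y) (innerEdges G Δ) := by
  ext e
  rw [Finset.mem_insert, mem_innerEdges, mem_innerEdges]
  induction e with
  | _ a b =>
    simp only [SimpleGraph.mem_edgeSet, Sym2.mem_iff, forall_eq_or_imp, forall_eq,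
      Finset.mem_insert, Sym2.eq_iff]
    constructor
    · rintro ⟨hab, rfl | ha, rfl | hb⟩
      · exact (hab.ne rfl).elim
      · exact Or.inl (Or.inl ⟨rfl, huniq b hb hab⟩)
      · exact Or.inl (Or.inr ⟨huniq a ha hab.symm, rfl⟩)
      · exact Or.inr ⟨hab, ha, hb⟩
    · rintro ((⟨rfl, rfl⟩ | ⟨rfl, rfl⟩) | ⟨hab, ha, hb⟩)
      · exact ⟨hyx.symm, Or.inl rfl, Or.inr hy⟩
      · exact ⟨hyx, Or.inr hy, Or.inl rfl⟩
      · exact ⟨hab, Or.inr ha, Or.inr hb⟩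

/-- The joint density, with respect to independent spins, of the spins in `Δ` for the pair
weight `Ψ`. -/
noncomputable def treeDensity (Ψ : Sym2 unitInterval → ℝ≥0∞) (Δ : Finset V)
    (ω : V → unitInterval) : ℝ≥0∞ :=
  ∏ e ∈ innerEdges G Δ, Ψ (e.map ω)

theorem innerEdges_singleton (x : V) : innerEdges G {x} = ∅ := by
  refine Finset.eq_empty_of_forall_notMem fun e he => ?_
  rw [mem_innerEdges] at he
  induction e with
  | _ a b =>
    simp only [SimpleGraph.mem_edgeSet, Sym2.mem_iff, forall_eq_or_imp, forall_eq,
      Finset.mem_singleton] at he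
    exact he.1.ne (he.2.1.trans he.2.2.symm)

variable {Ψ : Sym2 unitInterval → ℝ≥0∞}

theorem measurable_treeDensity
    (hΨ : Measurable fun p : unitInterval × unitInterval => Ψ s(p.1, p.2)) (Δ : Finset V) :
    Measurable (treeDensity G Ψ Δ) :=
  Finset.measurable_prod _ fun e _ => measurable_edge hΨ e

theorem dependsOn_treeDensity (Δ : Finset V) : DependsOn (treeDensity G Ψ Δ) Δ := by
  intro ω ω' h
  exact Finset.prod_congr rfl fun e he => by
    rw [map_edge_congr fun v hv => h v (((mem_innerEdges G).1 he).2 v hv)]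

/-- The new vertex is a leaf, so its spin enters through a single factor `Ψ s(ω y, u)`, whose
integral is `1`; neither `h` nor the old density sees it. -/
theorem lintegral_treeDensity_insert (m : Measure unitInterval) [IsProbabilityMeasure m]
    (hΨ : Measurable fun p : unitInterval × unitInterval => Ψ s(p.1, p.2))
    (hint : ∀ t, ∫⁻ u, Ψ s(t, u) ∂m = 1) (hG : G.IsAcyclic) {Δ : Finset V}
    (hΔ : (G.induce (Δ : Set V)).Preconnected) {x y : V} (hx : x ∉ Δ) (hy : y ∈ Δ)
    (hyx : G.Adj y x) {h : (V → unitInterval) → ℝ≥0∞} (hh : Measurable h)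
    (hdep : DependsOn h Δ) :
    ∫⁻ ω, h ω * treeDensity G Ψ (insert x Δ) ω ∂(Measure.infinitePi fun _ : V => m) =
      ∫⁻ ω, h ω * treeDensity G Ψ Δ ω ∂(Measure.infinitePi fun _ : V => m) := by
  rw [lintegral_infinitePi_eq_update m x 
    (by exact hh.mul (measurable_treeDensity G hΨ _))]
  refine lintegral_congr fun ω => ?_
  have hupd : ∀ u, ∀ i ∈ (Δ : Set V), Function.update ω x u i = ω i := fun u i hi =>
    Function.update_of_ne (by rintro rfl; exact hx hi) _ _
  have hyx' : y ≠ x := hyx.ne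
  have hnot : s(x, y) ∉ innerEdges G Δ := fun h =>
    hx (((mem_innerEdges G).1 h).2 x (Sym2.mem_mk_left x y))
  have key : ∀ u, h (Function.update ω x u) *
      treeDensity G Ψ (insert x Δ) (Function.update ω x u) =
      h ω * treeDensity G Ψ Δ ω * Ψ s(ω y, u) := by
    intro u
    rw [hdep (hupd u), ← dependsOn_treeDensity G Δ (hupd u), treeDensity,
      innerEdges_insert G hx hy hyx fun z hz hxz =>
        eq_of_adj_of_adj hG hΔ hx hz hy hxz hyx.symm, Finset.prod_insert hnot, Sym2.map_mk,
      Function.update_self, Function.update_of_ne hyx', Sym2.eq_swap, treeDensity]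
    ring
  simp_rw [key]
  rw [lintegral_const_mul _ (by exact hΨ.comp (measurable_prodMk_left (x := ω y))), hint, mul_one]

/-- Kolmogorov consistency: `Δ` is grown to `Δ'` one leaf at a time, by induction on the number of
missing vertices. -/
theorem lintegral_treeDensity_mono (m : Measure unitInterval) [IsProbabilityMeasure m]
    (hΨ : Measurable fun p : unitInterval × unitInterval => Ψ s(p.1, p.2))
    (hint : ∀ t, ∫⁻ u, Ψ s(t, u) ∂m = 1) (hG : G.IsAcyclic) {Δ Δ' : Finset V}
    (hΔ : (G.induce (Δ : Set V)).Connected) (hΔ' : (G.induce (Δ' : Set V)).Connected)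
    (hsub : Δ ⊆ Δ') {h : (V → unitInterval) → ℝ≥0∞} (hh : Measurable h) (hdep : DependsOn h Δ) :
    ∫⁻ ω, h ω * treeDensity G Ψ Δ' ω ∂(Measure.infinitePi fun _ : V => m) =
      ∫⁻ ω, h ω * treeDensity G Ψ Δ ω ∂(Measure.infinitePi fun _ : V => m) := by
  induction hn : (Δ' \ Δ).card using Nat.strong_induction_on generalizing Δ with
  | _ n ih =>
    rcases hsub.eq_or_ssubset with rfl | hss
    · rfl
    · obtain ⟨⟨a, ha⟩⟩ := hΔ.nonempty
      obtain ⟨x, hx', hx, y, hy, hyx⟩ := exists_adj_of_ssubset ⟨a, ha⟩ hss hΔ'.preconnected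
      rw [← lintegral_treeDensity_insert G m hΨ hint hG hΔ.preconnected hx hy hyx hh hdep]
      refine ih _ ?_ (connected_insert hΔ hy hyx) (Finset.insert_subset hx' hsub)
        (hdep.mono (by simp)) rfl
      rw [← hn]
      refine Finset.card_lt_card (Finset.ssubset_iff_of_subset
        (Finset.sdiff_subset_sdiff subset_rfl (Finset.subset_insert _ _)) |>.2 ⟨x, ?_⟩)
      simp [hx, hx']

theorem lintegral_treeDensity_eq_one (m : Measure unitInterval) [IsProbabilityMeasure m]
    (hΨ : Measurable fun p : unitInterval × unitInterval => Ψ s(p.1, p.2))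
    (hint : ∀ t, ∫⁻ u, Ψ s(t, u) ∂m = 1) (hG : G.IsAcyclic) {Δ : Finset V}
    (hΔ : (G.induce (Δ : Set V)).Connected) :
    ∫⁻ ω, treeDensity G Ψ Δ ω ∂(Measure.infinitePi fun _ : V => m) = 1 := by
  obtain ⟨⟨a, ha⟩⟩ := hΔ.nonempty
  have := lintegral_treeDensity_mono G m hΨ hint hG (connected_singleton a) hΔ
    (Finset.singleton_subset_iff.2 ha) (h := fun _ => 1) measurable_const (fun _ _ _ => rfl)
  simpa [treeDensity, innerEdges_singleton] using this

end TreeDensity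

/-! ### Infinite-volume measures with the tree densities -/

section TreeChain

variable {V : Type*} {G : SimpleGraph V}

/-- Measures on configurations are determined by the functions of finitely many spins forming a
connected set. -/
theorem ext_of_connected (hG : G.Connected) {μ ν : Measure (V → unitInterval)}
    [IsFiniteMeasure ν]
    (h : ∀ Δ : Finset V, (G.induce (Δ : Set V)).Connected → ∀ f : (V → unitInterval) → ℝ≥0∞,
      Measurable f → DependsOn f Δ → ∫⁻ ω, f ω ∂μ = ∫⁻ ω, f ω ∂ν) : μ = ν := by
  refine IsProjectiveLimit.unique (P := fun I => ν.map I.restrict) (fun I => ?_) fun I => rfl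
  obtain ⟨T, hIT, hT⟩ := exists_connected_superset hG I
  have hmeas : Measurable (I.restrict : (V → unitInterval) → _) := Finset.measurable_restrict I
  ext s hs
  rw [Measure.map_apply hmeas hs, Measure.map_apply hmeas hs,
    ← lintegral_indicator_one (hmeas hs), ← lintegral_indicator_one (hmeas hs)]
  refine h T hT _ (measurable_one.indicator (hmeas hs)) fun ω ω' hω => ?_
  have : I.restrict ω = I.restrict ω' := funext fun i => hω i (hIT i.2)
  exact congrArg (s.indicator fun _ => (1 : ℝ≥0∞)) this

variable (G) [DecidableEq V] [G.LocallyFinite]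

/-- `μ` has, for every finite connected `Δ`, the marginal density `treeDensity G Ψ Δ` with respect
to independent spins of law `m`. -/
def IsTreeChain (m : Measure unitInterval) (Ψ : Sym2 unitInterval → ℝ≥0∞)
    (μ : Measure (V → unitInterval)) : Prop :=
  ∀ Δ : Finset V, (G.induce (Δ : Set V)).Connected → ∀ f : (V → unitInterval) → ℝ≥0∞,
    Measurable f → DependsOn f Δ →
      ∫⁻ ω, f ω ∂μ = ∫⁻ ω, f ω * treeDensity G Ψ Δ ω ∂(Measure.infinitePi fun _ : V => m)

variable {G} {Ψ : Sym2 unitInterval → ℝ≥0∞} {m : Measure unitInterval}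

theorem lintegral_withDensity_treeDensity
    (hΨ : Measurable fun p : unitInterval × unitInterval => Ψ s(p.1, p.2))
    (P : Measure (V → unitInterval)) (Δ : Finset V) {f : (V → unitInterval) → ℝ≥0∞}
    (hf : Measurable f) :
    ∫⁻ ω, f ω ∂(P.withDensity (treeDensity G Ψ Δ)) = ∫⁻ ω, f ω * treeDensity G Ψ Δ ω ∂P := by
  rw [lintegral_withDensity_eq_lintegral_mul _ (measurable_treeDensity G hΨ Δ) hf]
  simp only [Pi.mul_apply, mul_comm]

/-- Each finite-volume density defines a probability measure on all of `[0,1]^V`; a weak limit point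
along growing volumes has the right marginals by consistency. -/
theorem exists_isTreeChain (hG : G.IsTree) [IsProbabilityMeasure m]
    (hΨ : Measurable fun p : unitInterval × unitInterval => Ψ s(p.1, p.2))
    (hint : ∀ t, ∫⁻ u, Ψ s(t, u) ∂m = 1) :
    ∃ μ : Measure (V → unitInterval), IsProbabilityMeasure μ ∧ IsTreeChain G m Ψ μ := by
  -- With countably many coordinates the product σ-algebra is the Borel one, as weak convergence
  -- requires.
  have : Countable V := countable_of_connected hG.connected
  choose T hT hTc using exists_connected_superset hG.connected
  set P := Measure.infinitePi fun _ : V => m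
  let μs : Finset V → ProbabilityMeasure (V → unitInterval) := fun S =>
    ⟨P.withDensity (treeDensity G Ψ (T S)), ⟨by
      rw [withDensity_apply _ .univ, Measure.restrict_univ]
      exact lintegral_treeDensity_eq_one G m hΨ hint hG.isAcyclic (hTc S)⟩⟩
  -- An ultrafilter finer than `atTop` converges by compactness, and eventually `Δ ⊆ S` along it.
  let U : Ultrafilter (Finset V) := Ultrafilter.of atTop
  let μ : ProbabilityMeasure (V → unitInterval) := (U.map μs).lim
  have hlim : Tendsto μs U (𝓝 μ) := (U.map μs).le_nhds_lim
  refine ⟨μ, inferInstance, fun Δ hΔ f hf hdep => ?_⟩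
  have hmeas : Measurable (Δ.restrict : (V → unitInterval) → _) := Finset.measurable_restrict Δ
  have hmap : (μ : Measure (V → unitInterval)).map Δ.restrict =
      (P.withDensity (treeDensity G Ψ Δ)).map Δ.restrict := by
    have : IsProbabilityMeasure ((μ : Measure (V → unitInterval)).map Δ.restrict) :=
      Measure.isProbabilityMeasure_map hmeas.aemeasurable
    refine ext_of_forall_lintegral_eq_of_IsFiniteMeasure fun g => ?_
    have hg : Measurable fun s : Δ → unitInterval => (g s : ℝ≥0∞) :=
      g.continuous.measurable.coe_nnreal_ennreal
    rw [lintegral_map hg hmeas, lintegral_map hg hmeas,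
      lintegral_withDensity_treeDensity hΨ P Δ (by exact hg.comp hmeas)]
    have ht := (ProbabilityMeasure.tendsto_iff_forall_lintegral_tendsto.1 hlim)
      (g.compContinuous ⟨Δ.restrict, continuous_pi fun i => continuous_apply _⟩)
    -- By consistency the integrals are eventually constant along `U`.
    refine tendsto_nhds_unique ht (tendsto_const_nhds.congr' ?_)
    have hle : (U : Filter (Finset V)) ≤ atTop := Ultrafilter.of_le atTop
    filter_upwards [hle (eventually_ge_atTop Δ)] with S hS
    have := lintegral_treeDensity_mono G m hΨ hint hG.isAcyclic hΔ (hTc S) (hS.trans (hT S))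
      (hg.comp hmeas) (fun ω ω' h => by
        have : Δ.restrict ω = Δ.restrict ω' := funext fun i => h i i.2
        simp [this])
    exact this.symm.trans (lintegral_withDensity_treeDensity hΨ P (T S) (hg.comp hmeas)).symm
  -- `f` factors through the restriction to `Δ`; the spin `0` outside is a dummy value.
  have hfac : ∀ ω, f ω = f (glue Δ (Δ.restrict ω) fun _ => 0) := fun ω =>
    hdep fun i hi => by rw [glue_of_mem hi]; rfl
  have hf' : Measurable fun s : Δ → unitInterval => f (glue Δ s fun _ => 0) :=
    hf.comp (measurable_glue_left Δ _)
  calc ∫⁻ ω, f ω ∂(μ : Measure (V → unitInterval))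
      = ∫⁻ s, f (glue Δ s fun _ => 0) ∂((μ : Measure (V → unitInterval)).map Δ.restrict) := by
        rw [lintegral_map hf' hmeas]
        exact lintegral_congr hfac
    _ = ∫⁻ ω, f ω ∂(P.withDensity (treeDensity G Ψ Δ)) := by
        rw [hmap, lintegral_map hf' hmeas]
        exact (lintegral_congr hfac).symm
    _ = _ := lintegral_withDensity_treeDensity hΨ P Δ hf

theorem treeDensity_comp_iso (g : G ≃g G) (Δ : Finset V) (ω : V → unitInterval) :
    treeDensity G Ψ Δ (fun x => ω (g x)) =
      treeDensity G Ψ (Δ.map g.toEquiv.toEmbedding) ω := by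
  have : innerEdges G (Δ.map g.toEquiv.toEmbedding) =
      (innerEdges G Δ).map ⟨Sym2.map g, Sym2.map.injective g.injective⟩ := by
    ext e
    rw [mem_innerEdges, Finset.mem_map]
    constructor
    · rintro ⟨he, hv⟩
      refine ⟨e.map g.symm, ?_, ?_⟩
      · rw [mem_innerEdges]
        induction e with
        | _ a b =>
          simp only [Sym2.mem_iff, forall_eq_or_imp, forall_eq, Finset.mem_map_equiv] at hv
          simp only [Sym2.map_mk, SimpleGraph.mem_edgeSet, Sym2.mem_iff, forall_eq_or_imp,
            forall_eq]
          exact ⟨g.symm.map_adj_iff.2 he, hv⟩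
      · induction e with
        | _ a b => simp
    · rintro ⟨e', he', rfl⟩
      rw [mem_innerEdges] at he'
      induction e' with
      | _ a b =>
        simp only [SimpleGraph.mem_edgeSet, Sym2.mem_iff, forall_eq_or_imp, forall_eq] at he'
        simp only [Function.Embedding.coeFn_mk, Sym2.map_mk, SimpleGraph.mem_edgeSet, Sym2.mem_iff,
          forall_eq_or_imp, forall_eq, Finset.mem_map_equiv]
        refine ⟨g.map_adj_iff.2 he'.1, ?_, ?_⟩
        · exact (g.toEquiv.symm_apply_apply a).symm ▸ he'.2.1
        · exact (g.toEquiv.symm_apply_apply b).symm ▸ he'.2.2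
  rw [treeDensity, treeDensity, this, Finset.prod_map]
  refine Finset.prod_congr rfl fun e _ => ?_
  rw [Function.Embedding.coeFn_mk, Sym2.map_map]
  rfl

/-- An automorphism carries the density of `Δ` to that of its image, which is again connected, and
relabelling preserves the product measure. -/
theorem IsTreeChain.isTranslationInvariant (hG : G.Connected) [IsProbabilityMeasure m]
    (hΨ : Measurable fun p : unitInterval × unitInterval => Ψ s(p.1, p.2))
    {μ : Measure (V → unitInterval)} [IsFiniteMeasure μ] (hμ : IsTreeChain G m Ψ μ) :
    IsTranslationInvariant G μ := by
  intro g
  have hmeas : Measurable fun (σ : V → unitInterval) (x : V) => σ (g x) := by fun_prop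
  refine ext_of_connected hG fun Δ hΔ f hf hdep => ?_
  have hconn : (G.induce ((Δ.map g.toEquiv.toEmbedding : Finset V) : Set V)).Connected := by
    refine hΔ.map (⟨fun v => ⟨g v, by simp⟩, fun h => g.map_adj_iff.2 h⟩ :
      G.induce (Δ : Set V) →g G.induce ((Δ.map g.toEquiv.toEmbedding : Finset V) : Set V)) ?_
    rintro ⟨v, hv⟩
    obtain ⟨w, hw, rfl⟩ := Finset.mem_map.1 hv
    exact ⟨⟨w, hw⟩, rfl⟩
  rw [lintegral_map hf hmeas, hμ Δ hΔ f hf hdep]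
  calc ∫⁻ ω, f (fun x => ω (g x)) ∂μ
      = ∫⁻ ω, f (fun x => ω (g x)) * treeDensity G Ψ Δ (fun x => ω (g x))
          ∂(Measure.infinitePi fun _ : V => m) := by
        simp only [treeDensity_comp_iso]
        exact hμ _ hconn _ (hf.comp hmeas) fun ω ω' h =>
          hdep fun i hi => h (g i) (by simpa using hi)
    _ = ∫⁻ ω, f ω * treeDensity G Ψ Δ ω ∂((Measure.infinitePi fun _ : V => m).map
          fun (σ : V → unitInterval) (x : V) => σ (g x)) :=
        (lintegral_map (hf.mul (measurable_treeDensity G hΨ Δ)) hmeas).symm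
    _ = _ := congrArg (fun ν => ∫⁻ ω, f ω * treeDensity G Ψ Δ ω ∂ν)
        (map_comp_equiv_infinitePi m g.toEquiv)

end TreeChain

/-! ### The DLR equations for tree chains -/

section DLR

variable {V : Type*} [DecidableEq V] (G : SimpleGraph V) [G.LocallyFinite]
  (Ψ : Sym2 unitInterval → ℝ≥0∞)

/-- The part of the density that involves the edges meeting `Λ`. -/
noncomputable def meetingDensity (Λ : Finset V) (ω : V → unitInterval) : ℝ≥0∞ :=
  ∏ e ∈ edgesMeeting G Λ, Ψ (e.map ω)

variable {G Ψ}

theorem measurable_meetingDensity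
    (hΨ : Measurable fun p : unitInterval × unitInterval => Ψ s(p.1, p.2)) (Λ : Finset V) :
    Measurable (meetingDensity G Ψ Λ) :=
  Finset.measurable_prod _ fun e _ => measurable_edge hΨ e

theorem measurable_weight {β : ℝ} {Φ : Sym2 unitInterval → ℝ}
    (hΦ : Measurable fun p : unitInterval × unitInterval => Φ s(p.1, p.2)) (Λ : Finset V)
    (ω : V → unitInterval) : Measurable (weight G β Φ Λ ω) := by
  have h : ∀ e : Sym2 V, Measurable fun σ : V → unitInterval => Φ (e.map σ) := fun e => by
    induction e with
    | _ a b => exact hΦ.comp (f := fun σ : V → unitInterval => (σ a, σ b)) (by fun_prop)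
  have hE : Measurable (energy G Φ Λ) := Finset.measurable_sum _ fun e _ => h e
  exact ((hE.comp (measurable_glue_left Λ ω)).const_mul _).exp.ennreal_ofReal

/-- The conditional law of independent spins of law `m` reweighted by the edges meeting `Λ` is
the Gibbs distribution with interaction `Φ`. -/
def IsGibbsDensity (G : SimpleGraph V) [G.LocallyFinite] (β : ℝ) (Φ : Sym2 unitInterval → ℝ)
    (m : Measure unitInterval) (Ψ : Sym2 unitInterval → ℝ≥0∞) : Prop :=
  ∀ (Λ : Finset V) (ω : V → unitInterval) (f : (V → unitInterval) → ℝ≥0∞), Measurable f →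
    ∫⁻ σ, f σ ∂(gibbsDist G β Φ Λ ω) =
      (∫⁻ s, meetingDensity G Ψ Λ (glue Λ s ω) ∂(Measure.pi fun _ : Λ => m))⁻¹ *
        ∫⁻ s, f (glue Λ s ω) * meetingDensity G Ψ Λ (glue Λ s ω) ∂(Measure.pi fun _ : Λ => m)

/-- The factor `R` does not depend on `s`, so it cancels between the integral and its normalisation;
in `ℝ≥0∞` this needs `R` nonzero and finite. -/
theorem isGibbsDensity_of_mul {β : ℝ} {Φ : Sym2 unitInterval → ℝ}
    (hΦ : Measurable fun p : unitInterval × unitInterval => Φ s(p.1, p.2))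
    (hΨ : Measurable fun p : unitInterval × unitInterval => Ψ s(p.1, p.2))
    {ρ : unitInterval → ℝ≥0∞} (hρ : Measurable ρ)
    [IsProbabilityMeasure ((volume : Measure unitInterval).withDensity ρ)]
    (hR : ∀ (Λ : Finset V) (ω : V → unitInterval), ∃ R : ℝ≥0∞, R ≠ 0 ∧ R ≠ ⊤ ∧
      ∀ s : Λ → unitInterval, (∏ i, ρ (s i)) * meetingDensity G Ψ Λ (glue Λ s ω) =
        R * weight G β Φ Λ ω s) :
    IsGibbsDensity G β Φ ((volume : Measure unitInterval).withDensity ρ) Ψ := by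
  intro Λ ω f hf
  obtain ⟨R, hR0, hRt, hR⟩ := hR Λ ω
  have hw := measurable_weight (G := G) (β := β) hΦ Λ ω
  have hg := measurable_glue_left Λ ω
  have hq := measurable_meetingDensity (G := G) hΨ Λ
  have hρ' : Measurable fun s : Λ → unitInterval => ∏ i, ρ (s i) :=
    Finset.measurable_prod _ fun i _ => hρ.comp (measurable_pi_apply i)
  have key : ∀ F : (V → unitInterval) → ℝ≥0∞, Measurable F →
      ∫⁻ s, F (glue Λ s ω) * meetingDensity G Ψ Λ (glue Λ s ω)
        ∂(Measure.pi fun _ : Λ => (volume : Measure unitInterval).withDensity ρ) =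
      R * ∫⁻ s, F (glue Λ s ω) * weight G β Φ Λ ω s ∂(apriori Λ) := by
    intro F hF
    rw [pi_withDensity hρ, lintegral_withDensity_eq_lintegral_mul _ hρ'
      (by exact (hF.mul hq).comp hg), ← lintegral_const_mul _ (by exact (hF.comp hg).mul hw)]
    refine lintegral_congr fun s => ?_
    simp only [Pi.mul_apply]
    rw [mul_left_comm, hR, mul_left_comm]
  have hZ := key (fun _ => 1) measurable_const
  simp only [one_mul] at hZ
  rw [key f hf, hZ, gibbsDist, lintegral_map hf hg,
    lintegral_withDensity_eq_lintegral_mul _ (hw.const_mul _) (by exact hf.comp hg)]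
  simp only [Pi.mul_apply, mul_assoc, mul_comm (weight G β Φ Λ ω _)]
  rw [lintegral_const_mul _ (by exact (hf.comp hg).mul hw),
    mul_comm _⁻¹ (R * _), ← div_eq_mul_inv, ENNReal.mul_div_mul_left _ _ hR0 hRt, div_eq_mul_inv,
    mul_comm]
  rfl

variable {m : Measure unitInterval} [IsProbabilityMeasure m]

theorem meetingDensity_lintegral_ne_zero
    (hΨ : Measurable fun p : unitInterval × unitInterval => Ψ s(p.1, p.2))
    (hpos : ∀ e, Ψ e ≠ 0) (Λ : Finset V) (ω : V → unitInterval) :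
    ∫⁻ s, meetingDensity G Ψ Λ (glue Λ s ω) ∂(Measure.pi fun _ : Λ => m) ≠ 0 := by
  intro h
  rw [lintegral_eq_zero_iff
    (by exact (measurable_meetingDensity hΨ Λ).comp (measurable_glue_left Λ ω))] at h
  obtain ⟨s, hs⟩ := h.exists
  exact Finset.prod_ne_zero_iff.2 (fun e _ => hpos _) hs

theorem meetingDensity_lintegral_ne_top {c : ℝ≥0∞} (hc : c ≠ ⊤) (hbd : ∀ e, Ψ e ≤ c)
    (Λ : Finset V) (ω : V → unitInterval) :
    ∫⁻ s, meetingDensity G Ψ Λ (glue Λ s ω) ∂(Measure.pi fun _ : Λ => m) ≠ ⊤ := by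
  refine ne_top_of_le_ne_top (b := c ^ (edgesMeeting G Λ).card)
    (ENNReal.pow_ne_top hc) ?_
  calc _ ≤ ∫⁻ _, c ^ (edgesMeeting G Λ).card ∂(Measure.pi fun _ : Λ => m) :=
        lintegral_mono fun s => Finset.prod_le_pow_card _ _ _ fun e _ => hbd _
    _ = _ := by simp

theorem edgesMeeting_subset_innerEdges {Λ T : Finset V}
    (hT : ∀ x ∈ Λ, x ∈ T ∧ ∀ y, G.Adj x y → y ∈ T) : edgesMeeting G Λ ⊆ innerEdges G T := by
  intro e he
  obtain ⟨he, x, hx, hxe⟩ := (mem_edgesMeeting G).1 he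
  refine (mem_innerEdges G).2 ⟨he, fun v hv => ?_⟩
  obtain ⟨y, rfl⟩ := hxe
  rcases Sym2.mem_iff.1 hv with rfl | rfl
  exacts [(hT _ hx).1, (hT _ hx).2 _ he]

/-- The density on a large `T` splits into the edges meeting `Λ` and a factor `r` blind to the spins
in `Λ`. Resampling `Λ` under the product measure then makes the partition function cancel. -/
theorem IsTreeChain.isGibbsMeasure (hG : G.Connected) {β : ℝ} {Φ : Sym2 unitInterval → ℝ}
    (hΨ : Measurable fun p : unitInterval × unitInterval => Ψ s(p.1, p.2))
    (hpos : ∀ e, Ψ e ≠ 0) {c : ℝ≥0∞} (hc : c ≠ ⊤) (hbd : ∀ e, Ψ e ≤ c)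
    (hΦ : IsGibbsDensity G β Φ m Ψ) {μ : Measure (V → unitInterval)} [IsProbabilityMeasure μ]
    (hμ : IsTreeChain G m Ψ μ) : IsGibbsMeasure G β Φ μ := by
  refine ⟨inferInstance, fun Λ A hA => ?_⟩
  have hq := measurable_meetingDensity (G := G) hΨ Λ
  have hZm : Measurable fun ω => ∫⁻ s, meetingDensity G Ψ Λ (glue Λ s ω)
      ∂(Measure.pi fun _ : Λ => m) :=
    (hq.comp (measurable_glue_prod Λ)).lintegral_prod_left'
  have hFm : ∀ f : (V → unitInterval) → ℝ≥0∞, Measurable f → Measurable fun ω =>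
      ∫⁻ s, f (glue Λ s ω) * meetingDensity G Ψ Λ (glue Λ s ω)
        ∂(Measure.pi fun _ : Λ => m) := fun f hf =>
    ((hf.mul hq).comp (measurable_glue_prod Λ)).lintegral_prod_left'
  have hκ : Measurable (gibbsDist G β Φ Λ) := by
    refine Measure.measurable_of_measurable_coe _ fun B hB => ?_
    simp_rw [← lintegral_indicator_one hB]
    simp_rw [hΦ Λ _ _ (measurable_one.indicator hB)]
    exact hZm.inv.mul (hFm _ (measurable_one.indicator hB))
  -- The DLR equation says that `μ` is invariant under the kernel, which can be tested on functions
  -- of finitely many spins.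
  suffices h : μ.bind (gibbsDist G β Φ Λ) = μ by
    rw [← Measure.bind_apply hA hκ.aemeasurable, h]
  refine ext_of_connected hG fun Δ hΔ f hf hdep => ?_
  -- `T` contains `Λ` with all its neighbours, hence every edge meeting `Λ`.
  obtain ⟨T, hsub, hT⟩ := exists_connected_superset hG
    (Δ ∪ (Λ ∪ Λ.biUnion fun x => G.neighborFinset x))
  have hΔT : Δ ⊆ T := Finset.subset_union_left.trans hsub
  have hΛT : ∀ x ∈ Λ, x ∈ T ∧ ∀ y, G.Adj x y → y ∈ T := fun x hx =>
    ⟨hsub (by simp [hx]), fun y hy => hsub (by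
      simp only [Finset.mem_union, Finset.mem_biUnion, SimpleGraph.mem_neighborFinset]
      exact Or.inr (Or.inr ⟨x, hx, hy⟩))⟩
  have hEM := edgesMeeting_subset_innerEdges hΛT
  replace hdep : DependsOn f T := hdep.mono (by exact_mod_cast hΔT)
  have hqdep : DependsOn (meetingDensity G Ψ Λ) T := fun ω ω' h =>
    Finset.prod_congr rfl fun e he => by
      rw [map_edge_congr fun v hv => h v (((mem_innerEdges G).1 (hEM he)).2 v hv)]
  have hgdep : ∀ {ω ω' : V → unitInterval}, (∀ i ∈ (T : Set V), ω i = ω' i) →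
      ∀ s : Λ → unitInterval, ∀ i ∈ (T : Set V), glue Λ s ω i = glue Λ s ω' i := by
    intro ω ω' h s i hi
    by_cases hiΛ : i ∈ Λ
    · simp [glue, hiΛ]
    · simp [glue, hiΛ, h i hi]
  set r : (V → unitInterval) → ℝ≥0∞ := fun ω =>
    ∏ e ∈ innerEdges G T \ edgesMeeting G Λ, Ψ (e.map ω) with hr
  have hrglue : ∀ s ω, r (glue Λ s ω) = r ω := fun s ω => Finset.prod_congr rfl fun e he => by
    rw [map_edge_congr fun v hv => glue_of_notMem (fun hvΛ => ?_) s ω]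
    rw [Finset.mem_sdiff, mem_innerEdges, mem_edgesMeeting] at he
    exact he.2 ⟨he.1.1, v, hvΛ, hv⟩
  have hD : ∀ ω, treeDensity G Ψ T ω = meetingDensity G Ψ Λ ω * r ω := fun ω => by
    rw [treeDensity, meetingDensity, hr, mul_comm, Finset.prod_sdiff hEM]
  rw [Measure.lintegral_bind hκ.aemeasurable hf.aemeasurable, hμ T hT f hf hdep]
  simp_rw [hΦ Λ _ _ hf]
  rw [hμ T hT _ (by exact hZm.inv.mul (hFm f hf)) ?_]
  · have hDm := measurable_treeDensity G hΨ T
    rw [lintegral_infinitePi_eq_glue m Λ (by exact (hZm.inv.mul (hFm f hf)).mul hDm)]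
    refine Eq.trans ?_ (lintegral_infinitePi_eq_glue m Λ
      (h := fun ω => f ω * treeDensity G Ψ T ω) (hf.mul hDm)).symm
    refine lintegral_congr fun ω => ?_
    have hg := measurable_glue_left Λ ω
    simp only [glue_glue, hD, hrglue]
    have hZ0 := meetingDensity_lintegral_ne_zero (G := G) (m := m) hΨ hpos Λ ω
    have hZt := meetingDensity_lintegral_ne_top (G := G) (m := m) hc hbd Λ ω
    have hq' : Measurable fun s => meetingDensity G Ψ Λ (glue Λ s ω) := hq.comp hg
    have hfq : Measurable fun s => f (glue Λ s ω) * meetingDensity G Ψ Λ (glue Λ s ω) :=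
      (hf.mul hq).comp hg
    simp_rw [← mul_assoc (f _)]
    rw [lintegral_mul_const _ hfq, lintegral_const_mul _ (hq'.mul_const _),
      lintegral_mul_const _ hq', ← mul_assoc, mul_right_comm (_⁻¹),
      ENNReal.inv_mul_cancel hZ0 hZt, one_mul]
  · intro ω ω' h
    simp only [hqdep (hgdep h _), hdep (hgdep h _)]

end DLR

/-! ### From boundary laws to Gibbs measures -/

section BoundaryLaw

variable {V : Type*} [DecidableEq V] {G : SimpleGraph V} [G.LocallyFinite]

/-- The product of the values of `f` at the two ends of an edge. -/
def edgeProd (f : unitInterval → ℝ) : Sym2 unitInterval → ℝ :=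
  Sym2.lift ⟨fun t u => f t * f u, fun _ _ => mul_comm _ _⟩

theorem edgeProd_mk (f : unitInterval → ℝ) (t u : unitInterval) :
    edgeProd f s(t, u) = f t * f u := rfl

theorem edgeProd_pos {f : unitInterval → ℝ} (hf : ∀ t, 0 < f t) (e : Sym2 unitInterval) :
    0 < edgeProd f e := by
  induction e with
  | _ a b => exact mul_pos (hf a) (hf b)

/-- On a regular graph, the product over the edges meeting `Λ` of the boundary values is a product
over the sites in `Λ` up to a factor that depends only on the configuration outside `Λ`. -/
theorem prod_edgeProd_edgesMeeting {k : ℕ} (hdeg : G.IsRegularOfDegree (k + 1))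
    (f : unitInterval → ℝ) (Λ : Finset V) (s : Λ → unitInterval) (ω : V → unitInterval) :
    ∏ e ∈ edgesMeeting G Λ, edgeProd f (e.map (glue Λ s ω)) =
      (∏ i, f (s i) ^ (k + 1)) *
        ∏ e ∈ edgesMeeting G Λ, ∏ v ∈ e.toFinset with v ∉ Λ, f (ω v) := by
  have h1 : ∀ e ∈ edgesMeeting G Λ, edgeProd f (e.map (glue Λ s ω)) =
      (∏ v ∈ e.toFinset with v ∈ Λ, f (glue Λ s ω v)) *
        ∏ v ∈ e.toFinset with v ∉ Λ, f (ω v) := by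
    intro e he
    have h2 : ∏ v ∈ e.toFinset with v ∉ Λ, f (ω v) =
        ∏ v ∈ e.toFinset with v ∉ Λ, f (glue Λ s ω v) :=
      Finset.prod_congr rfl fun v hv => by rw [glue_of_notMem (Finset.mem_filter.1 hv).2]
    rw [h2, Finset.prod_filter_mul_prod_filter_not]
    have he' := ((mem_edgesMeeting G).1 he).1
    induction e with
    | _ a b =>
      rw [Sym2.toFinset_mk_eq, Finset.prod_pair (G.ne_of_adj he'), Sym2.map_mk, edgeProd_mk]
  rw [Finset.prod_congr rfl h1, Finset.prod_mul_distrib]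
  congr 1
  -- Exchanging the products, each site of `Λ` is counted once for each of its `k + 1` edges, all of
  -- which meet `Λ`.
  rw [Finset.prod_comm' (t' := Λ) (s' := fun v => G.incidenceFinset v)]
  · simp_rw [Finset.prod_const, SimpleGraph.card_incidenceFinset_eq_degree, hdeg.degree_eq]
    rw [← Finset.prod_attach Λ, Finset.univ_eq_attach]
    exact Finset.prod_congr rfl fun i _ => by rw [glue_of_mem i.2]
  · intro e v
    rw [mem_edgesMeeting, Finset.mem_filter, Sym2.mem_toFinset, SimpleGraph.mem_incidenceFinset]
    constructor
    · rintro ⟨h, h', hv⟩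
      exact ⟨⟨h.1, h'⟩, hv⟩
    · rintro ⟨⟨h, h'⟩, hv⟩
      exact ⟨⟨h, v, hv, h'⟩, h', hv⟩

theorem weight_eq (β : ℝ) (Φ : Sym2 unitInterval → ℝ) (Λ : Finset V) (ω : V → unitInterval)
    (s : Λ → unitInterval) : weight G β Φ Λ ω s =
      ENNReal.ofReal (∏ e ∈ edgesMeeting G Λ, Real.exp (-β * Φ (e.map (glue Λ s ω)))) := by
  rw [weight, energy, Finset.mul_sum, Real.exp_sum]

/-- A positive continuous solution `f` of the boundary law equation on a regular tree yields an
automorphism-invariant Gibbs measure whose single-site marginals have density proportional to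
`f ^ (k + 1)`. -/
theorem exists_gibbsMeasure_of_boundaryLaw (hG : G.IsTree) {k : ℕ}
    (hdeg : G.IsRegularOfDegree (k + 1)) {β : ℝ} {Φ : Sym2 unitInterval → ℝ}
    (hΦ : Continuous fun p : unitInterval × unitInterval => Φ s(p.1, p.2))
    {f : unitInterval → ℝ} (hf : Continuous f) (hpos : ∀ t, 0 < f t) {lam : ℝ} (hlam : 0 < lam)
    (hlaw : ∀ t, ∫ u, Real.exp (-β * Φ s(t, u)) * f u ^ k = lam * f t) :
    ∃ μ : Measure (V → unitInterval), IsGibbsMeasure G β Φ μ ∧ IsTranslationInvariant G μ ∧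
      ∀ (o : V) (g : unitInterval → ℝ≥0∞), Measurable g → ∫⁻ ω, g (ω o) ∂μ =
        ∫⁻ u, g u * ENNReal.ofReal (f u ^ (k + 1) / ∫ v, f v ^ (k + 1)) := by
  set Z : ℝ := ∫ v, f v ^ (k + 1) with hZdef
  have hint : ∀ {g : unitInterval → ℝ}, Continuous g → Integrable g := fun hg =>
    hg.integrable_of_hasCompactSupport (HasCompactSupport.of_compactSpace _)
  have hZ : 0 < Z := by
    refine (integral_pos_iff_support_of_nonneg (f := fun v => f v ^ (k + 1))
      (fun t => (pow_pos (hpos t) _).le) (hint (hf.pow (k + 1)))).2 ?_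
    have : Function.support (fun v => f v ^ (k + 1)) = Set.univ :=
      Set.eq_univ_of_forall fun t => (pow_pos (hpos t) _).ne'
    rw [this]
    simp
  set ρ : unitInterval → ℝ≥0∞ := fun u => ENNReal.ofReal (f u ^ (k + 1) / Z) with hρdef
  have hρ : Measurable ρ := ((hf.pow (k + 1)).div_const Z).measurable.ennreal_ofReal
  -- Against `ρ u`, the factor `1 / f u` leaves `f u ^ k` and `Z` cancels, so the boundary law makes
  -- `w` a transition density relative to `m`.
  set w : Sym2 unitInterval → ℝ := fun e => Z / lam * (Real.exp (-β * Φ e) / edgeProd f e) with hw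
  have hwpos : ∀ e, 0 < w e := fun e =>
    mul_pos (div_pos hZ hlam) (div_pos (Real.exp_pos _) (edgeProd_pos hpos e))
  have hwc : Continuous fun p : unitInterval × unitInterval => w s(p.1, p.2) := by
    refine continuous_const.mul (Continuous.div ?_ ?_ fun p => (edgeProd_pos hpos _).ne')
    · exact Real.continuous_exp.comp (continuous_const.mul hΦ)
    · exact (hf.comp continuous_fst).mul (hf.comp continuous_snd)
  set Ψ : Sym2 unitInterval → ℝ≥0∞ := fun e => ENNReal.ofReal (w e) with hΨdef
  have hΨ : Measurable fun p : unitInterval × unitInterval => Ψ s(p.1, p.2) :=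
    hwc.measurable.ennreal_ofReal
  have hΨpos : ∀ e, Ψ e ≠ 0 := fun e => (ENNReal.ofReal_pos.2 (hwpos e)).ne'
  obtain ⟨c, hc⟩ : ∃ c, ∀ e, w e ≤ c := by
    obtain ⟨c, hc⟩ := isCompact_univ.exists_bound_of_continuousOn hwc.continuousOn
    refine ⟨c, fun e => ?_⟩
    induction e with
    | _ a b => exact (le_abs_self _).trans (hc (a, b) trivial)
  set m : Measure unitInterval := (volume : Measure unitInterval).withDensity ρ with hm
  have hmprob : IsProbabilityMeasure m := ⟨by
    rw [hm, withDensity_apply _ .univ, Measure.restrict_univ,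
      ← ofReal_integral_eq_lintegral_ofReal (f := fun u => f u ^ (k + 1) / Z)
        (hint ((hf.pow (k + 1)).div_const Z))
        (ae_of_all _ fun t => (div_pos (pow_pos (hpos t) _) hZ).le),
      integral_div, div_self hZ.ne', ENNReal.ofReal_one]⟩
  have hmint : ∀ t, ∫⁻ u, Ψ s(t, u) ∂m = 1 := by
    intro t
    have hfac : ∀ u, ρ u * Ψ s(t, u) =
        ENNReal.ofReal (Real.exp (-β * Φ s(t, u)) * f u ^ k / (lam * f t)) := by
      intro u
      rw [hρdef, hΨdef, ← ENNReal.ofReal_mul (div_pos (pow_pos (hpos u) _) hZ).le]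
      congr 1
      simp only [hw, edgeProd_mk]
      have := (hpos t).ne'
      have := (hpos u).ne'
      field_simp
      ring
    have hcont : Continuous fun u => Real.exp (-β * Φ s(t, u)) * f u ^ k := by
      refine Continuous.mul (Real.continuous_exp.comp (continuous_const.mul ?_)) (hf.pow k)
      exact hΦ.comp (Continuous.prodMk_right t)
    rw [hm, lintegral_withDensity_eq_lintegral_mul _ hρ
      (by exact hΨ.comp (measurable_prodMk_left (x := t)))]
    simp only [Pi.mul_apply, hfac]
    rw [← ofReal_integral_eq_lintegral_ofReal (hint (hcont.div_const _))
        (ae_of_all _ fun u => (div_pos (mul_pos (Real.exp_pos _) (pow_pos (hpos u) _))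
          (mul_pos hlam (hpos t))).le),
      integral_div, hlaw, div_self (mul_pos hlam (hpos t)).ne', ENNReal.ofReal_one]
  have hdens : IsGibbsDensity G β Φ m Ψ := by
    refine isGibbsDensity_of_mul hΦ.measurable hΨ hρ fun Λ ω => ?_
    set B : ℝ := ∏ e ∈ edgesMeeting G Λ, ∏ v ∈ e.toFinset with v ∉ Λ, f (ω v) with hB
    have hBpos : 0 < B := Finset.prod_pos fun e _ => Finset.prod_pos fun v _ => hpos _
    -- Each edge meeting `Λ` contributes `Z / lam`, each site of `Λ` contributes `1 / Z`, and `B`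
    -- collects the values of `f` at the outer endpoints.
    set R : ℝ := Z ^ (edgesMeeting G Λ).card /
      (Z ^ Fintype.card Λ * lam ^ (edgesMeeting G Λ).card * B) with hR
    have hRpos : 0 < R := by positivity
    refine ⟨ENNReal.ofReal R, (ENNReal.ofReal_pos.2 hRpos).ne', ENNReal.ofReal_ne_top,
      fun s => ?_⟩
    rw [weight_eq, meetingDensity, hρdef, hΨdef,
      ← ENNReal.ofReal_prod_of_nonneg fun i _ => (div_pos (pow_pos (hpos _) _) hZ).le,
      ← ENNReal.ofReal_prod_of_nonneg fun e _ => (hwpos _).le,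
      ← ENNReal.ofReal_mul (Finset.prod_nonneg fun i _ => (div_pos (pow_pos (hpos _) _) hZ).le),
      ← ENNReal.ofReal_mul hRpos.le]
    congr 1
    simp only [hw, Finset.prod_mul_distrib, Finset.prod_div_distrib, Finset.prod_const,
      Finset.card_univ]
    rw [prod_edgeProd_edgesMeeting hdeg, ← hB, hR]
    have hs : ∏ i, f (s i) ^ (k + 1) ≠ 0 :=
      (Finset.prod_pos fun i _ => pow_pos (hpos _) _).ne'
    field_simp
  obtain ⟨μ, hμp, hμ⟩ := exists_isTreeChain (m := m) hG hΨ hmint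
  refine ⟨μ, hμ.isGibbsMeasure hG.connected hΨ hΨpos ENNReal.ofReal_ne_top
    (fun e => ENNReal.ofReal_le_ofReal (hc e)) hdens,
    hμ.isTranslationInvariant hG.connected hΨ, fun o g hg => ?_⟩
  -- A single vertex has no inner edges, so its marginal is `m`.
  rw [hμ {o} (connected_singleton o) _
    (by exact hg.comp (measurable_pi_apply o)) fun ω ω' h => by
    simp [h o (by simp)]]
  simp only [treeDensity, innerEdges_singleton, Finset.prod_empty, mul_one]
  rw [(measurePreserving_eval_infinitePi (fun _ : V => m) o).lintegral_comp hg, hm,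
    lintegral_withDensity_eq_lintegral_mul _ hρ hg]
  simp only [Pi.mul_apply, mul_comm, hρdef]

end BoundaryLaw

/-! ### Integrals of powers of affine functions -/

section Moments

theorem integral_unitInterval (φ : ℝ → ℝ) :
    ∫ u : unitInterval, φ u = ∫ x in (0 : ℝ)..1, φ x := by
  rw [intervalIntegral.integral_of_le zero_le_one, ← integral_Icc_eq_integral_Ioc]
  exact integral_subtype measurableSet_Icc φ

theorem integral_affine_pow {c : ℝ} (hc : c ≠ 0) (j : ℕ) :
    ∫ x in (0 : ℝ)..1, (1 + c * (x - 1 / 2)) ^ j =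
      ((1 + c / 2) ^ (j + 1) - (1 - c / 2) ^ (j + 1)) / (c * (j + 1)) := by
  have hj : (j : ℝ) + 1 ≠ 0 := by positivity
  have hderiv : ∀ x ∈ Set.uIcc (0 : ℝ) 1,
      HasDerivAt (fun x : ℝ => (1 + c * (x - 1 / 2)) ^ (j + 1) / (c * (j + 1)))
        ((1 + c * (x - 1 / 2)) ^ j) x := by
    intro x _
    have h : HasDerivAt (fun x : ℝ => 1 + c * (x - 1 / 2)) (c * 1) x :=
      (((hasDerivAt_id x).sub_const (1 / 2)).const_mul c).const_add 1
    refine HasDerivAt.congr_deriv ((h.fun_pow (j + 1)).div_const (c * (j + 1))) ?_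
    push_cast [Nat.add_sub_cancel]
    field_simp
  rw [intervalIntegral.integral_eq_sub_of_hasDerivAt hderiv
    (Continuous.intervalIntegrable (by fun_prop) _ _), ← sub_div]
  congr 2 <;> congr 1 <;> ring

theorem mul_integral_centered_affine_pow (c : ℝ) (j : ℕ) :
    c * ∫ x in (0 : ℝ)..1, (x - 1 / 2) * (1 + c * (x - 1 / 2)) ^ j =
      (∫ x in (0 : ℝ)..1, (1 + c * (x - 1 / 2)) ^ (j + 1)) -
        ∫ x in (0 : ℝ)..1, (1 + c * (x - 1 / 2)) ^ j := by
  rw [← intervalIntegral.integral_const_mul, ← intervalIntegral.integral_sub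
    (Continuous.intervalIntegrable (by fun_prop) _ _)
    (Continuous.intervalIntegrable (by fun_prop) _ _)]
  refine intervalIntegral.integral_congr fun x _ => ?_
  ring

theorem affine_pos {c : ℝ} (hc : 0 ≤ c) (hc1 : c < 1) {x : ℝ} (hx : 0 ≤ x) :
    0 < 1 + c * (x - 1 / 2) := by
  nlinarith [mul_nonneg hc hx]

theorem integral_affine_pow_pos {c : ℝ} (hc : 0 ≤ c) (hc1 : c < 1) (j : ℕ) :
    0 < ∫ x in (0 : ℝ)..1, (1 + c * (x - 1 / 2)) ^ j :=
  intervalIntegral.intervalIntegral_pos_of_pos_on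
    (Continuous.intervalIntegrable (by fun_prop) _ _)
    (fun _ hx => pow_pos (affine_pos hc hc1 hx.1.le) j) zero_lt_one

/-- The affine factor is at least `1` right of `1/2` and in `(0,1]` left of it, so raising it to the
power `j` only increases the integrand; for `j = 1` the integral is `c / 12`. -/
theorem integral_centered_affine_pow_pos {c : ℝ} (hc : 0 < c) (hc1 : c < 1) {j : ℕ} (hj : 1 ≤ j) :
    0 < ∫ x in (0 : ℝ)..1, (x - 1 / 2) * (1 + c * (x - 1 / 2)) ^ j := by
  have hlow : ∫ x in (0 : ℝ)..1, (x - 1 / 2) * (1 + c * (x - 1 / 2)) = c / 12 := by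
    have : ∀ x ∈ Set.uIcc (0 : ℝ) 1, HasDerivAt
        (fun x : ℝ => (x - 1 / 2) ^ 2 / 2 + c * ((x - 1 / 2) ^ 3 / 3))
        ((x - 1 / 2) * (1 + c * (x - 1 / 2))) x := by
      intro x _
      have h : HasDerivAt (fun x : ℝ => x - 1 / 2) 1 x := (hasDerivAt_id x).sub_const (1 / 2)
      refine HasDerivAt.congr_deriv
        (((h.fun_pow 2).div_const 2).add (((h.fun_pow 3).div_const 3).const_mul c)) ?_
      norm_num
      ring
    rw [intervalIntegral.integral_eq_sub_of_hasDerivAt this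
      (Continuous.intervalIntegrable (by fun_prop) _ _)]
    ring
  have hmono : ∫ x in (0 : ℝ)..1, (x - 1 / 2) * (1 + c * (x - 1 / 2)) ≤
      ∫ x in (0 : ℝ)..1, (x - 1 / 2) * (1 + c * (x - 1 / 2)) ^ j := by
    refine intervalIntegral.integral_mono_on zero_le_one
      (Continuous.intervalIntegrable (by fun_prop) _ _)
      (Continuous.intervalIntegrable (by fun_prop) _ _) fun x hx => ?_
    rcases le_total 0 (x - 1 / 2) with h | h
    · refine mul_le_mul_of_nonneg_left (le_self_pow₀ ?_ (by omega)) h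
      have := mul_nonneg hc.le h
      linarith
    · refine mul_le_mul_of_nonpos_left (pow_le_of_le_one ?_ ?_ (by omega)) h
      · exact (affine_pos hc.le hc1 hx.1).le
      · have := mul_nonpos_of_nonneg_of_nonpos hc.le h
        linarith
  linarith

end Moments

/-! ### The affine boundary laws of the kernel -/

theorem kernel_pos {γ : ℝ} (hγ : |γ| < 4) (t u : unitInterval) : 0 < kernel γ t u := by
  have ht : |(t : ℝ) - 1 / 2| ≤ 1 / 2 := abs_le.2 ⟨by linarith [t.2.1], by linarith [t.2.2]⟩
  have hu : |(u : ℝ) - 1 / 2| ≤ 1 / 2 := abs_le.2 ⟨by linarith [u.2.1], by linarith [u.2.2]⟩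
  have h : |γ * (t - 1 / 2) * (u - 1 / 2)| < 1 := by
    rw [abs_mul, abs_mul]
    have h1 := abs_nonneg γ
    have h2 := mul_le_mul ht hu (abs_nonneg _) (by norm_num)
    nlinarith [mul_le_mul_of_nonneg_left h2 h1]
  rw [kernel]
  linarith [(abs_lt.1 h).1]

theorem interaction_mk (β γ : ℝ) (t u : unitInterval) :
    interaction β γ s(t, u) = -(1 / β) * Real.log (kernel γ t u) := rfl

theorem exp_interaction {β γ : ℝ} (hβ : 0 < β) (hγ : |γ| < 4) (t u : unitInterval) :
    Real.exp (-β * interaction β γ s(t, u)) = kernel γ t u := by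
  rw [interaction_mk, show -β * (-(1 / β) * Real.log (kernel γ t u)) = Real.log (kernel γ t u) by
    field_simp, Real.exp_log (kernel_pos hγ t u)]

theorem continuous_interaction (β : ℝ) {γ : ℝ} (hγ : |γ| < 4) :
    Continuous fun p : unitInterval × unitInterval => interaction β γ s(p.1, p.2) := by
  simp only [interaction_mk]
  refine continuous_const.mul (Continuous.log ?_ fun p => (kernel_pos hγ _ _).ne')
  unfold kernel
  fun_prop

/-- An affine function solves the boundary law equation for the kernel. -/
theorem integral_kernel_mul_affine_pow (γ c : ℝ) (k : ℕ) (t : unitInterval)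
    (h : γ * (∫ x in (0 : ℝ)..1, (x - 1 / 2) * (1 + c * (x - 1 / 2)) ^ k) =
      c * ∫ x in (0 : ℝ)..1, (1 + c * (x - 1 / 2)) ^ k) :
    ∫ u : unitInterval, kernel γ t u * (1 + c * ((u : ℝ) - 1 / 2)) ^ k =
      (∫ x in (0 : ℝ)..1, (1 + c * (x - 1 / 2)) ^ k) * (1 + c * ((t : ℝ) - 1 / 2)) := by
  rw [integral_unitInterval fun x => kernel γ t x * (1 + c * (x - 1 / 2)) ^ k]
  have hx : ∀ x : ℝ, kernel γ t x * (1 + c * (x - 1 / 2)) ^ k =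
      (1 + c * (x - 1 / 2)) ^ k +
        (γ * ((t : ℝ) - 1 / 2)) * ((x - 1 / 2) * (1 + c * (x - 1 / 2)) ^ k) := fun x => by
    rw [kernel]
    ring
  simp_rw [hx]
  rw [intervalIntegral.integral_add (Continuous.intervalIntegrable (by fun_prop) _ _)
    (Continuous.intervalIntegrable (by fun_prop) _ _), intervalIntegral.integral_const_mul]
  linear_combination ((t : ℝ) - 1 / 2) * h

/-- The defining equation of `ξ(k;n)` says that the affine function of slope `ξ(k;n)^(n-1)` solves
the boundary law equation with coupling `C_n(k)`. -/
theorem C_mul_integral_eq {k n : ℕ} (hk : 1 ≤ k) (hn : k < n) {x : ℝ} (hx : x ∈ Set.Ioo (0 : ℝ) 1)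
    (hPQ : P k n x = Q k n x) :
    C k n x * (∫ y in (0 : ℝ)..1, (y - 1 / 2) * (1 + x ^ (n - 1) * (y - 1 / 2)) ^ k) =
      x ^ (n - 1) * ∫ y in (0 : ℝ)..1, (1 + x ^ (n - 1) * (y - 1 / 2)) ^ k := by
  have hc : 0 < x ^ (n - 1) := pow_pos hx.1 _
  have hc1 : x ^ (n - 1) < 1 := pow_lt_one₀ hx.1.le hx.2 (by omega)
  have hB := integral_centered_affine_pow_pos hc hc1 hk
  have hcB := mul_integral_centered_affine_pow (x ^ (n - 1)) k
  have hA := integral_affine_pow hc.ne' k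
  have hA' := integral_affine_pow hc.ne' (k + 1)
  -- `3n - k - 2 = 2(n - 1) + (n - k)`; since `n > k ≥ 1`, no subtraction truncates.
  have hexp : x ^ (3 * n - k - 2) = (x ^ (n - 1)) ^ 2 * x ^ (n - k) := by
    rw [← pow_mul, ← pow_add]
    congr 1
    omega
  rw [P, Q] at hPQ
  rw [C, hexp]
  set c := x ^ (n - 1)
  set A := ∫ y in (0 : ℝ)..1, (1 + c * (y - 1 / 2)) ^ k
  set A' := ∫ y in (0 : ℝ)..1, (1 + c * (y - 1 / 2)) ^ (k + 1)
  set B := ∫ y in (0 : ℝ)..1, (y - 1 / 2) * (1 + c * (y - 1 / 2)) ^ k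
  have hcA : c * A = x ^ (n - k) := by
    rw [hA, hPQ]
    field_simp
  -- The bracket is `c` times the integral of the `(k+1)`-st power; subtracting `c * A` leaves `c *
  -- (A' - A) = c ^ 2 * B`.
  have hden : 1 / (2 + (k : ℝ)) * ((1 + c / 2) ^ (k + 2) - (1 - c / 2) ^ (k + 2)) - x ^ (n - k) =
      c ^ 2 * B := by
    have : 1 / (2 + (k : ℝ)) * ((1 + c / 2) ^ (k + 2) - (1 - c / 2) ^ (k + 2)) = c * A' := by
      rw [hA']
      push_cast
      field_simp
      ring
    rw [this, ← hcA]
    linear_combination -c * hcB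
  rw [hden, hcA]
  field_simp

/-- The Gibbs measure attached to an affine solution of the boundary law equation, with the mean
of its centred single-site marginals. -/
theorem exists_affine_gibbsMeasure {V : Type*} [DecidableEq V] {G : SimpleGraph V}
    [G.LocallyFinite] (hG : G.IsTree) {k : ℕ} (hdeg : G.IsRegularOfDegree (k + 1)) {β γ : ℝ}
    (hβ : 0 < β) (hγ : |γ| < 4) {c : ℝ} (hc : 0 ≤ c) (hc1 : c < 1)
    (h : γ * (∫ x in (0 : ℝ)..1, (x - 1 / 2) * (1 + c * (x - 1 / 2)) ^ k) =
      c * ∫ x in (0 : ℝ)..1, (1 + c * (x - 1 / 2)) ^ k) :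
    ∃ μ : Measure (V → unitInterval), IsGibbsMeasure G β (interaction β γ) μ ∧
      IsTranslationInvariant G μ ∧ ∀ o : V, ∫ ω, ((ω o : ℝ) - 1 / 2) ∂μ =
        (∫ x in (0 : ℝ)..1, (x - 1 / 2) * (1 + c * (x - 1 / 2)) ^ (k + 1)) /
          ∫ x in (0 : ℝ)..1, (1 + c * (x - 1 / 2)) ^ (k + 1) := by
  have hpos : ∀ t : unitInterval, 0 < 1 + c * ((t : ℝ) - 1 / 2) := fun t =>
    affine_pos hc hc1 t.2.1
  obtain ⟨μ, hμ, hinv, hmarg⟩ := exists_gibbsMeasure_of_boundaryLaw hG hdeg (β := β)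
    (continuous_interaction β hγ) (f := fun t => 1 + c * ((t : ℝ) - 1 / 2)) (by fun_prop) hpos
    (integral_affine_pow_pos hc hc1 k) fun t => by
      simp_rw [exp_interaction hβ hγ]
      exact integral_kernel_mul_affine_pow γ c k t h
  refine ⟨μ, hμ, hinv, fun o => ?_⟩
  have hZ := integral_unitInterval fun x => (1 + c * (x - 1 / 2)) ^ (k + 1)
  simp only [hZ] at hmarg
  set Z := ∫ x in (0 : ℝ)..1, (1 + c * (x - 1 / 2)) ^ (k + 1)
  have hZpos : 0 < Z := integral_affine_pow_pos hc hc1 (k + 1)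
  have hmap : μ.map (fun ω => ω o) = (volume : Measure unitInterval).withDensity fun u =>
      ENNReal.ofReal ((1 + c * ((u : ℝ) - 1 / 2)) ^ (k + 1) / Z) := by
    refine Measure.ext_of_lintegral _ fun g hg => ?_
    rw [lintegral_map hg (measurable_pi_apply o), hmarg o g hg,
      lintegral_withDensity_eq_lintegral_mul _ (by fun_prop) hg]
    simp only [Pi.mul_apply, mul_comm]
  rw [← integral_map (φ := fun ω : V → unitInterval => ω o)
    (f := fun u : unitInterval => (u : ℝ) - 1 / 2) (measurable_pi_apply o).aemeasurable
    (Continuous.aestronglyMeasurable (by fun_prop)), hmap,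
    integral_withDensity_eq_integral_toReal_smul (by fun_prop)
      (ae_of_all _ fun _ => ENNReal.ofReal_lt_top),
    ← intervalIntegral.integral_div,
    ← integral_unitInterval fun x => (x - 1 / 2) * (1 + c * (x - 1 / 2)) ^ (k + 1) / Z]
  refine integral_congr_ae (ae_of_all _ fun u => ?_)
  simp only [smul_eq_mul]
  rw [ENNReal.toReal_ofReal (div_pos (pow_pos (hpos u) _) hZpos).le]
  ring

end CayleyGibbs

theorem theorem5p9 {V : Type*} [DecidableEq V] (G : SimpleGraph V) [G.LocallyFinite]
    (k : ℕ) (hk : 4 ≤ k) (hG : G.IsTree) (hdeg : G.IsRegularOfDegree (k + 1))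
    (ξ : ℕ → ℝ) (hξ : CayleyGibbs.IsRootSequence k ξ)
    (n : ℕ → ℕ) (hn : CayleyGibbs.IsLimsupSubsequence k ξ n)
    (p : ℕ) (hp : p ∈ CayleyGibbs.N0 k ξ n)
    (β : ℝ) (hβ : 0 < β) :
    ∃ μ₁ μ₂ : MeasureTheory.Measure (V → unitInterval),
      μ₁ ≠ μ₂ ∧
      CayleyGibbs.IsGibbsMeasure G β
        (CayleyGibbs.interaction β (CayleyGibbs.gam k ξ n p)) μ₁ ∧
      CayleyGibbs.IsTranslationInvariant G μ₁ ∧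
      CayleyGibbs.IsGibbsMeasure G β
        (CayleyGibbs.interaction β (CayleyGibbs.gam k ξ n p)) μ₂ ∧
      CayleyGibbs.IsTranslationInvariant G μ₂ := by
  have hkn := hn.gt p
  obtain ⟨hx, hPQ⟩ := hξ (n p) hkn
  have hγ : |CayleyGibbs.gam k ξ n p| < 4 := hp
  have hγB := CayleyGibbs.C_mul_integral_eq (by omega) hkn hx hPQ
  have hc : 0 < ξ (n p) ^ (n p - 1) := pow_pos hx.1 _
  have hc1 : ξ (n p) ^ (n p - 1) < 1 := pow_lt_one₀ hx.1.le hx.2 (by omega)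
  rw [← CayleyGibbs.gam] at hγB
  set γ := CayleyGibbs.gam k ξ n p
  set c := ξ (n p) ^ (n p - 1)
  -- The constant boundary law: the condition holds because `x - 1 / 2` has integral zero.
  obtain ⟨μ₁, hμ₁, hinv₁, hmarg₁⟩ := CayleyGibbs.exists_affine_gibbsMeasure hG hdeg hβ hγ
    (c := 0) le_rfl zero_lt_one (by simp)
  obtain ⟨μ₂, hμ₂, hinv₂, hmarg₂⟩ := CayleyGibbs.exists_affine_gibbsMeasure hG hdeg hβ hγ
    hc.le hc1 hγB
  refine ⟨μ₁, μ₂, fun h => ?_, hμ₁, hinv₁, hμ₂, hinv₂⟩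
  obtain ⟨o⟩ := hG.connected.nonempty
  have h1 := hmarg₁ o
  rw [h, hmarg₂ o] at h1
  have hpos := CayleyGibbs.integral_centered_affine_pow_pos hc hc1 (j := k + 1) (by omega)
  have hZ := CayleyGibbs.integral_affine_pow_pos hc.le hc1 (k + 1)
  have := div_pos hpos hZ
  -- The mean for `c = 0` is zero, so equality would force the numerator or the denominator of the
  -- other mean to vanish.
  simp at h1
  rcases h1 with h1 | h1 <;> linarith
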